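/- A commuting structure on a set $S$ is a reflexive symmetric relation $\sim$ on $S$, and $NC(S)$ is the simplicial complex with vertex set $S$ whose faces are the nonempty finite subsets of $S$ in which no two distinct elements are related by $\sim$. (1) Let $S$ be a finite nonempty set with a commuting structure $\sim$ that is also transitive, i.e. an equivalence relation, with equivalence classes of sizes $m_1,\dots,m_n$. Then the geometric realization of $NC(S)$ is homotopy equivalent to a wedge of $\prod_{i=1}^n (m_i-1)$ spheres of dimension $n-1$; if this number is $0$, the wedge is a point. (2) Let $G$ be a finite nonabelian group with center $Z(G)$ that is a TC-group, i.e. commuting is a transitive relation on $G\setminus Z(G)$. Let $nc(G)$ be the maximal size of a set of pairwise non-commuting elements of $G$, and let $BNC(G)=NC(G\setminus Z(G))$, where $x\sim y$ means $xy=yx$. Let $C_1,\dots,C_r$ be the distinct proper subgroups of $G$ that are centralizers $C_G(x)$ of elements $x\in G$, and put $m_i=|C_i\setminus Z(G)|=|C_i|-|Z(G)|$. Then the geometric realization of $BNC(G)$ is homotopy equivalent to a wedge of $\prod_{i=1}^r (m_i-1)$ spheres of dimension $nc(G)-1$; if this number is $0$, the wedge is a point. -/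

import Mathlib

open scoped ContinuousMap

/-- A commuting structure on `S`: a reflexive, symmetric relation ("`x` and `y` commute"). -/
structure CommutingStructure (S : Type*) where
  rel : S → S → Prop
  refl : ∀ x, rel x x
  symm : ∀ x y, rel x y → rel y x

namespace CommutingStructure

variable {S : Type*}

/-- The dual structure: distinct elements are related iff they do not commute. -/
def dual (A : CommutingStructure S) : CommutingStructure S where
  rel x y := x = y ∨ ¬ A.rel x y
  refl _ := Or.inl rfl
  symm x y h := h.elim (fun e => Or.inl e.symm) (fun e => Or.inr fun h' => e (A.symm y x h'))

/-- The commuting complex `C(S)`: its faces are the nonempty finite commuting subsets of `S`. -/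
def commutingComplex (A : CommutingStructure S) : AbstractSimplicialComplex S where
  faces := {s | s.Nonempty ∧ ∀ x ∈ s, ∀ y ∈ s, A.rel x y}
  isRelLowerSet_faces := fun _ hs =>
    ⟨hs.1, fun _ hts ht => ⟨ht, fun x hx y hy => hs.2 x (hts hx) y (hts hy)⟩⟩
  singleton_mem v := ⟨Finset.singleton_nonempty v, fun x hx y hy => by
    rw [Finset.mem_singleton.mp hx, Finset.mem_singleton.mp hy]
    exact A.refl v⟩

/-- The non-commuting complex `NC(S)`, the commuting complex of the dual structure. -/
def NC (A : CommutingStructure S) : AbstractSimplicialComplex S :=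
  A.dual.commutingComplex

/-- The commuting relation is transitive. -/
def IsTransitive (A : CommutingStructure S) : Prop :=
  ∀ x y z, A.rel x y → A.rel y z → A.rel x z

/-- A transitive commuting relation, as an equivalence relation. -/
def toSetoid (A : CommutingStructure S) (h : A.IsTransitive) : Setoid S where
  r := A.rel
  iseqv := ⟨A.refl, fun {x y} => A.symm x y, fun {x y z} => h x y z⟩

/-- The set of equivalence classes of a transitive commuting relation. -/
abbrev Classes (A : CommutingStructure S) (h : A.IsTransitive) : Type _ :=
  Quotient (A.toSetoid h)

/-- The number of elements of an equivalence class. -/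
noncomputable def classSize (A : CommutingStructure S) (h : A.IsTransitive)
    (c : A.Classes h) : ℕ :=
  Nat.card {x : S // Quotient.mk (A.toSetoid h) x = c}

/-- The noncentral elements of a group with the relation of commuting in the group. -/
def noncentral (G : Type*) [Group G] : CommutingStructure {g : G // g ∉ Subgroup.center G} where
  rel x y := Commute (x : G) (y : G)
  refl x := Commute.refl (x : G)
  symm _ _ h := Commute.symm h

end CommutingStructure

/-- The geometric realization of a simplicial complex with finitely many vertices: the points of
the standard simplex in `V → ℝ` that are supported on a face. As `V` is finite, the subspace
topology from `V → ℝ` is the usual topology of the realization. -/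
abbrev Realization {V : Type*} [Finite V] (K : AbstractSimplicialComplex V) : Type _ :=
  {t : V → ℝ // (∀ v, 0 ≤ t v) ∧ ∃ s ∈ K.faces, (∀ v, v ∉ s → t v = 0) ∧ ∑ v ∈ s, t v = 1}

/-- Glue every base point `x j` to one extra point. -/
inductive WedgeRel {J : Type*} {X : J → Type*} (x : ∀ j, X j) :
    (Σ j, X j) ⊕ Unit → (Σ j, X j) ⊕ Unit → Prop
  | glue (j : J) : WedgeRel x (Sum.inl ⟨j, x j⟩) (Sum.inr ())

/-- The wedge of a family of pointed spaces, with the quotient topology. The empty wedge is a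
point. -/
abbrev Wedge {J : Type*} (X : J → Type*) (x : ∀ j, X j) : Type _ :=
  Quot (WedgeRel x)

/-- The `d`-dimensional unit sphere. -/
abbrev UnitSphere (d : ℕ) : Type :=
  Metric.sphere (0 : EuclideanSpace ℝ (Fin (d + 1))) 1

/-- The first unit vector as base point of the sphere. -/
noncomputable def UnitSphere.base (d : ℕ) : UnitSphere d :=
  ⟨EuclideanSpace.single 0 1, by simp⟩

/-- The wedge of `k` spheres of dimension `d`. -/
abbrev WedgeOfSpheres (d k : ℕ) : Type :=
  Wedge (fun _ : Fin k => UnitSphere d) (fun _ => UnitSphere.base d)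

/-- The complex `BNC(G)` of non-commuting sets of noncentral elements of `G`. -/
def BNC (G : Type*) [Group G] : AbstractSimplicialComplex {g : G // g ∉ Subgroup.center G} :=
  (CommutingStructure.noncentral G).NC

/-- A TC-group: commuting is transitive on the noncentral elements. -/
def IsTCGroup (G : Type*) [Group G] : Prop :=
  (CommutingStructure.noncentral G).IsTransitive

/-- The maximal size of a set of pairwise non-commuting elements of a finite group. -/
noncomputable def nc (G : Type*) [Group G] [Finite G] : ℕ :=
  sSup {k | ∃ s : Finset G, (s : Set G).Pairwise (fun x y => ¬ Commute x y) ∧ s.card = k}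

/-- The set of (distinct) proper centralizers of elements of `G`. -/
def properCentralizers (G : Type*) [Group G] : Set (Subgroup G) :=
  {H | (∃ x : G, H = Subgroup.centralizer {x}) ∧ H ≠ ⊤}

/-! A face of `NC` has at most one vertex in each class, so the realization is the join of the
classes as discrete sets (`realization_iff`). Fix a base point in every class. A choice of one
nonbase point per class spans, together with the base points, the boundary of a cross-polytope: an
(n-1)-sphere whose points are the rays of signed weights y in `C → ℝ`, base points counting
negatively. There are ∏ (m_i - 1) such spheres, all containing the simplex of base points, whose
barycentre is the ray of -1. Everything outside the open simplices of the choices should contract to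
that barycentre.

The contraction is explicit. `shift` moves y to αy - β, where α, β ≥ 0 depend only on y and the
time; it never hits 0 (`shift_ne_zero`), and at time 1 it sends every y with a coordinate ≤ 0 to the
ray of -1. The cone over a class has one negative ray (the base point) and many positive ones; as α,
β ≥ 0, the same formula makes sense there and gives a motion `slidePoint` of the whole join.
`collapse` records the choice and the direction of the shifted vector, `expand` includes the spheres
as cross-polytopes, and both composites are time 1 of a motion starting at the identity
(`expand_collapse`, `slideWedge_one`).

In a TC-group the classes of noncentral elements are the sets C_G(x) \ Z(G), one for each proper
centralizer, and representatives of them form a largest non-commuting set. -/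

/-! ### Weights on the cross-polytope of a choice -/

section CrossPolytope

variable {S C : Type*} {q : S → C} {b : C → S}

/-- A choice of a point different from the base point in each fibre. -/
abbrev NonbaseChoice (q : S → C) (b : C → S) : Type _ := ∀ c, {s : S // q s = c ∧ s ≠ b c}

open Classical in
/-- The weights with signed weight `y` that are supported on the base points and on `j`. -/
noncomputable def choiceWeight (b : C → S) (j : NonbaseChoice q b) (y : C → ℝ) (s : S) : ℝ :=
  if s = b (q s) then max (-y (q s)) 0 else if s = j (q s) then max (y (q s)) 0 else 0

theorem choiceWeight_nonneg (j : NonbaseChoice q b) (y : C → ℝ) (s : S) : 0 ≤ choiceWeight b j y s := by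
  unfold choiceWeight
  split_ifs <;> simp

/-- Only `b c` and `j c` can carry weight in the fibre of `c`, namely the negative and the positive
part of the same number. -/
theorem choiceWeight_disjoint (j : NonbaseChoice q b) (y : C → ℝ) (u v : S) (huv : q u = q v) (hne : u ≠ v) :
    choiceWeight b j y u = 0 ∨ choiceWeight b j y v = 0 := by
  unfold choiceWeight
  rw [huv]
  split_ifs with h1 h2 h3 h4 h5
  · exact absurd (h1.trans h2.symm) hne
  · rcases le_total (y (q v)) 0 with h | h
    · exact Or.inr (max_eq_right h)
    · exact Or.inl (max_eq_right (by linarith))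
  all_goals try simp
  · rcases le_total (y (q v)) 0 with h | h
    · exact Or.inl h
    · exact Or.inr h
  · exact absurd (by assumption) (by rintro h; exact hne (by simp_all))

theorem choiceWeight_smul (j : NonbaseChoice q b) {k : ℝ} (hk : 0 ≤ k) (y : C → ℝ) (s : S) :
    choiceWeight b j (k • y) s = k * choiceWeight b j y s := by
  unfold choiceWeight
  split_ifs
  · rw [mul_max_of_nonneg _ _ hk]; simp
  · rw [mul_max_of_nonneg _ _ hk]; simp
  · simp

theorem continuous_choiceWeight (j : NonbaseChoice q b) : Continuous (choiceWeight b j) := by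
  refine continuous_pi fun s => ?_
  unfold choiceWeight
  split_ifs <;> fun_prop

end CrossPolytope

/-! ### The join of discrete fibres and its signed weights -/

section Join

variable {S C : Type*} [Fintype S]

/-- The join of the fibres of `q`, as discrete spaces, in barycentric coordinates. -/
abbrev JoinSpace (q : S → C) : Type _ :=
  {t : S → ℝ // (∀ v, 0 ≤ t v) ∧ (∀ u v, q u = q v → u ≠ v → t u = 0 ∨ t v = 0) ∧ ∑ v, t v = 1}

theorem sum_pos_of_exists_ne_zero {t : S → ℝ} (h0 : ∀ v, 0 ≤ t v) (h2 : ∃ v, t v ≠ 0) :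
    0 < ∑ v, t v := by
  obtain ⟨v, hv⟩ := h2
  exact Finset.sum_pos' (fun v _ => h0 v)
    ⟨v, Finset.mem_univ v, lt_of_le_of_ne (h0 v) hv.symm⟩

/-- Rescale a nonzero weight function that is supported on a simplex to a point of the join. -/
noncomputable def JoinSpace.normalize {q : S → C} (t : S → ℝ) (h0 : ∀ v, 0 ≤ t v)
    (h1 : ∀ u v, q u = q v → u ≠ v → t u = 0 ∨ t v = 0) (h2 : ∃ v, t v ≠ 0) : JoinSpace q :=
  ⟨fun s => t s / ∑ v, t v, fun v => div_nonneg (h0 v) (Finset.sum_nonneg fun v _ => h0 v),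
    fun u v huv hne => (h1 u v huv hne).imp (fun h => by simp [h]) (fun h => by simp [h]), by
      rw [← Finset.sum_div, div_self (sum_pos_of_exists_ne_zero h0 h2).ne']⟩

theorem JoinSpace.normalize_eq_normalize {q : S → C} {t t' : S → ℝ} {h0 h1 h2 h0' h1' h2'}
    {k : ℝ} (hk : k ≠ 0) (h : ∀ s, t s = k * t' s) :
    JoinSpace.normalize (q := q) t h0 h1 h2 = JoinSpace.normalize t' h0' h1' h2' := by
  ext s
  simp only [JoinSpace.normalize, h, ← Finset.mul_sum]
  rw [mul_div_mul_left _ _ hk]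

theorem JoinSpace.exists_ne_zero {q : S → C} (x : JoinSpace q) : ∃ s, x.1 s ≠ 0 := by
  by_contra! h
  have := x.2.2.2
  simp [h] at this

open Classical in
/-- The signed total weight of each fibre, where base points count negatively. -/
noncomputable def signedWeight (q : S → C) (b : C → S) (t : S → ℝ) (c : C) : ℝ :=
  ∑ s, if q s = c then (if s = b c then - t s else t s) else 0

theorem continuous_signedWeight (q : S → C) (b : C → S) : Continuous (signedWeight q b) := by
  refine continuous_pi fun c => continuous_finsetSum _ fun s _ => ?_
  split_ifs <;> fun_prop

variable {q : S → C} {b : C → S}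

theorem signedWeight_div (t : S → ℝ) (k : ℝ) (c : C) :
    signedWeight q b (fun s => t s / k) c = signedWeight q b t c / k := by
  unfold signedWeight
  rw [Finset.sum_div]
  refine Finset.sum_congr rfl fun s _ => ?_
  split_ifs <;> simp [neg_div]

open Classical in
theorem signedWeight_eq_of_ne_zero (x : JoinSpace q) {s : S} (hs : x.1 s ≠ 0) :
    signedWeight q b x.1 (q s) = if s = b (q s) then - x.1 s else x.1 s := by
  unfold signedWeight
  rw [Finset.sum_eq_single s]
  · simp
  · intro u _ hu
    split_ifs with h h'
    · rw [(x.2.2.1 u s h hu).resolve_right hs, neg_zero]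
    · exact (x.2.2.1 u s h hu).resolve_right hs
    · rfl
  · simp

theorem signedWeight_eq_zero (x : JoinSpace q) {c : C} (h : ∀ s, q s = c → x.1 s = 0) :
    signedWeight q b x.1 c = 0 := by
  refine Finset.sum_eq_zero fun s _ => ?_
  split_ifs with h1 h2
  · simp [h s h1]
  · exact h s h1
  · rfl

/-- Each fibre has at most one nonzero weight, so nothing cancels. -/
theorem signedWeight_ne_zero (x : JoinSpace q) : signedWeight q b x.1 ≠ 0 := by
  classical
  obtain ⟨s, hs⟩ := x.exists_ne_zero
  intro h
  have h1 := signedWeight_eq_of_ne_zero (b := b) x hs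
  rw [h, Pi.zero_apply] at h1
  split_ifs at h1
  · exact hs (neg_eq_zero.mp h1.symm)
  · exact hs h1.symm

/-- A positive signed weight is the weight of a point other than the base point. -/
theorem exists_of_signedWeight_pos (x : JoinSpace q) {c : C} (h : 0 < signedWeight q b x.1 c) :
    ∃ s, q s = c ∧ s ≠ b c ∧ x.1 s = signedWeight q b x.1 c := by
  classical
  have : ∃ s, q s = c ∧ x.1 s ≠ 0 := by
    by_contra! h'
    exact h.ne' (signedWeight_eq_zero x h')
  obtain ⟨s, rfl, hs⟩ := this
  have h1 := signedWeight_eq_of_ne_zero (b := b) x hs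
  split_ifs at h1 with h2
  · have := x.2.1 s
    linarith
  · exact ⟨s, rfl, h2, h1.symm⟩

theorem signedWeight_eq_of_ne_base (x : JoinSpace q) {s : S} (hs : x.1 s ≠ 0) (h : s ≠ b (q s)) :
    signedWeight q b x.1 (q s) = x.1 s := by
  classical
  rw [signedWeight_eq_of_ne_zero x hs, if_neg h]

/-- If the base point has no weight, all weight of the fibre counts positively; otherwise the base
point has all of it. -/
theorem max_neg_signedWeight (hb : ∀ c, q (b c) = c) (x : JoinSpace q) (c : C) :
    max (-signedWeight q b x.1 c) 0 = x.1 (b c) := by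
  classical
  by_cases h : x.1 (b c) = 0
  · rw [h, max_eq_right_iff, neg_nonpos]
    by_contra! h'
    have : ∃ s, q s = c ∧ x.1 s ≠ 0 := by
      by_contra! h''
      exact h'.ne (signedWeight_eq_zero x h'')
    obtain ⟨s, rfl, hs⟩ := this
    have h1 := signedWeight_eq_of_ne_zero (b := b) x hs
    split_ifs at h1 with h2
    · exact hs (by rw [h2]; exact h)
    · have := x.2.1 s
      linarith
  · have h1 := signedWeight_eq_of_ne_zero (b := b) x h
    rw [hb, if_pos rfl] at h1
    rw [h1, neg_neg, max_eq_left (x.2.1 _)]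

/-! ### Sliding towards the base points -/

open Classical in
/-- The effect of `y ↦ α y - β` on each fibre, the cone over a discrete space. -/
noncomputable def slideWeight (q : S → C) (b : C → S) (α β : ℝ) (t : S → ℝ) (s : S) : ℝ :=
  if s = b (q s) then max (-(α * signedWeight q b t (q s) - β)) 0 else max (α * t s - β) 0

theorem slideWeight_nonneg (α β : ℝ) (t : S → ℝ) (s : S) : 0 ≤ slideWeight q b α β t s := by
  unfold slideWeight
  split_ifs <;> exact le_max_right _ _

/-- Since `β ≥ 0`, nonbase points without weight stay without weight. If a nonbase point has weight,
its new weight and that of the base point are the positive parts of opposite numbers. -/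
theorem slideWeight_disjoint {α β : ℝ} (hβ : 0 ≤ β) (x : JoinSpace q) (u v : S)
    (huv : q u = q v) (hne : u ≠ v) :
    slideWeight q b α β x.1 u = 0 ∨ slideWeight q b α β x.1 v = 0 := by
  have key : ∀ u v, q u = q v → u = b (q u) → v ≠ b (q v) →
      slideWeight q b α β x.1 u = 0 ∨ slideWeight q b α β x.1 v = 0 := by
    intro u v huv hu hv
    unfold slideWeight
    rw [if_pos hu, if_neg hv]
    by_cases h : x.1 v = 0
    · right
      simpa [h] using hβ
    · have h1 := signedWeight_eq_of_ne_base x h hv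
      rw [huv, h1]
      rcases le_total (α * x.1 v - β) 0 with h2 | h2
      · exact Or.inr (max_eq_right h2)
      · exact Or.inl (max_eq_right (by linarith))
  by_cases hu : u = b (q u) <;> by_cases hv : v = b (q v)
  · exact absurd (hu.trans (by rw [huv, ← hv])) hne
  · exact key u v huv hu hv
  · exact (key v u huv.symm hv hu).symm
  · unfold slideWeight
    rw [if_neg hu, if_neg hv]
    exact (x.2.2.1 u v huv hne).imp (fun h => by simpa [h] using hβ) (fun h => by simpa [h] using hβ)

theorem slideWeight_exists_ne_zero (hb : ∀ c, q (b c) = c) {α β : ℝ} (hα : 0 ≤ α) (hβ : 0 ≤ β)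
    (x : JoinSpace q) (h : ∃ c, α * signedWeight q b x.1 c - β ≠ 0) :
    ∃ s, slideWeight q b α β x.1 s ≠ 0 := by
  obtain ⟨c, hc⟩ := h
  rcases lt_or_gt_of_ne hc with hc | hc
  · refine ⟨b c, ?_⟩
    unfold slideWeight
    rw [hb, if_pos rfl]
    exact (lt_max_of_lt_left (by linarith)).ne'
  -- As `α, β ≥ 0`, a positive value of `α y - β` forces `y > 0`, so a nonbase point of this fibre
  -- carries the weight.
  · have : 0 < signedWeight q b x.1 c := by
      by_contra! h'
      nlinarith
    obtain ⟨s, rfl, h1, h2⟩ := exists_of_signedWeight_pos x this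
    refine ⟨s, ?_⟩
    unfold slideWeight
    rw [if_neg h1, h2]
    exact (lt_max_of_lt_left hc).ne'

theorem slideWeight_one_zero (hb : ∀ c, q (b c) = c) (x : JoinSpace q) :
    slideWeight q b 1 0 x.1 = x.1 := by
  ext s
  unfold slideWeight
  split_ifs with h
  · rw [one_mul, sub_zero, max_neg_signedWeight hb, ← h]
  · rw [one_mul, sub_zero, max_eq_left (x.2.1 s)]

theorem continuous_slideWeight :
    Continuous fun p : ℝ × ℝ × (S → ℝ) => slideWeight q b p.1 p.2.1 p.2.2 := by
  refine continuous_pi fun s => ?_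
  have h : Continuous fun p : ℝ × ℝ × (S → ℝ) => signedWeight q b p.2.2 (q s) :=
    (continuous_apply (q s)).comp ((continuous_signedWeight q b).comp (by fun_prop))
  unfold slideWeight
  split_ifs <;> fun_prop

/-! ### Points of a cross-polytope -/

theorem signedWeight_choiceWeight (j : NonbaseChoice q b) (hb : ∀ c, q (b c) = c) (y : C → ℝ) (c : C) :
    signedWeight q b (choiceWeight b j y) c = y c := by
  classical
  have : ∀ s, (if q s = c then (if s = b c then - choiceWeight b j y s else choiceWeight b j y s)
      else 0) = (if s = b c then -max (-y c) 0 else 0) +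
        (if s = (j c).1 then max (y c) 0 else 0) := by
    intro s
    by_cases h : q s = c
    · subst h
      unfold choiceWeight
      by_cases h1 : s = b (q s)
      · have : s ≠ (j (q s)).1 := fun h => (j (q s)).2.2 (h ▸ h1)
        rw [if_pos rfl, if_pos h1, if_pos h1, if_pos h1, if_neg this, add_zero]
      · rw [if_pos rfl, if_neg h1, if_neg h1, if_neg h1, zero_add]
    · rw [if_neg h, if_neg, if_neg, add_zero]
      · rintro rfl
        exact h (j c).2.1
      · rintro rfl
        exact h (hb c)
  unfold signedWeight
  rw [Finset.sum_congr rfl fun s _ => this s, Finset.sum_add_distrib]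
  simp only [Finset.sum_ite_eq', Finset.mem_univ, if_true]
  rcases le_total (y c) 0 with h | h
  · rw [max_eq_left (by linarith), max_eq_right h]; ring
  · rw [max_eq_right (by linarith), max_eq_left h]; ring

theorem choiceWeight_exists_ne_zero (j : NonbaseChoice q b) (hb : ∀ c, q (b c) = c) {y : C → ℝ} (hy : y ≠ 0) :
    ∃ s, choiceWeight b j y s ≠ 0 := by
  by_contra! h
  apply hy
  ext c
  rw [← signedWeight_choiceWeight j hb y c]
  refine Finset.sum_eq_zero fun s _ => ?_
  simp [h s]

/-- On the cross-polytope of `j`, sliding is the map `y ↦ α y - β`. -/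
theorem slideWeight_eq_choiceWeight (j : NonbaseChoice q b) {α β : ℝ} (hβ : 0 ≤ β) (x : JoinSpace q)
    (hx : ∀ c, x.1 (j c) ≠ 0) :
    slideWeight q b α β x.1 = choiceWeight b j (fun c => α * signedWeight q b x.1 c - β) := by
  ext s
  unfold slideWeight choiceWeight
  split_ifs with h1 h2
  · rfl
  · have hs : x.1 s ≠ 0 := by rw [h2]; exact hx _
    simp only [signedWeight_eq_of_ne_base x hs h1]
  · have : x.1 s = 0 := (x.2.2.1 s (j (q s)) (j (q s)).2.1.symm h2).resolve_right (hx _)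
    simpa [this] using hβ

end Join

/-! ### The contracting motion of signed weights -/

section Shift

variable {C : Type*} [Fintype C] [Nonempty C]

/-- The positive part of the least coordinate. -/
noncomputable def minPos (y : C → ℝ) : ℝ :=
  max (Finset.univ.inf' Finset.univ_nonempty y) 0

theorem continuous_minPos : Continuous (minPos : (C → ℝ) → ℝ) :=
  (Continuous.finset_inf'_apply _ fun i _ => continuous_apply i).max continuous_const

theorem minPos_nonneg (y : C → ℝ) : 0 ≤ minPos y := le_max_right _ _

theorem minPos_eq_zero {y : C → ℝ} {c : C} (h : y c ≤ 0) : minPos y = 0 :=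
  max_eq_right ((Finset.inf'_le _ (Finset.mem_univ c)).trans h)

theorem minPos_const {k : ℝ} (h : 0 ≤ k) : minPos (fun _ : C => k) = k := by
  rw [minPos, Finset.inf'_const, max_eq_left h]

/-- The factor of the motion towards the base direction, at time `t`. -/
noncomputable def shiftScale (t : ℝ) (y : C → ℝ) : ℝ := 1 - t + t * minPos y

/-- The translation part of the motion towards the base direction, at time `t`. -/
noncomputable def shiftAmount (t : ℝ) (y : C → ℝ) : ℝ := t * ‖y - fun _ => minPos y‖

/-- A straight-line motion towards the direction `-1`. At time `1`, all vectors that have a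
coordinate `≤ 0` have reached that direction, and the positive orthant covers all directions. -/
noncomputable def shift (t : ℝ) (y : C → ℝ) (c : C) : ℝ := shiftScale t y * y c - shiftAmount t y

theorem continuous_shiftScale : Continuous fun p : ℝ × (C → ℝ) => shiftScale p.1 p.2 := by
  have := continuous_minPos.comp (continuous_snd : Continuous (Prod.snd : ℝ × (C → ℝ) → _))
  unfold shiftScale
  exact ((continuous_const.sub continuous_fst).add (continuous_fst.mul this))

theorem continuous_shiftAmount : Continuous fun p : ℝ × (C → ℝ) => shiftAmount p.1 p.2 := by
  have := continuous_minPos.comp (continuous_snd : Continuous (Prod.snd : ℝ × (C → ℝ) → _))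
  unfold shiftAmount
  exact continuous_fst.mul (continuous_snd.sub (continuous_pi fun _ => this)).norm

theorem continuous_shift : Continuous fun p : ℝ × (C → ℝ) => shift p.1 p.2 :=
  continuous_pi fun c => (continuous_shiftScale.mul ((continuous_apply c).comp continuous_snd)).sub
    continuous_shiftAmount

theorem shiftScale_nonneg {t : ℝ} (h0 : 0 ≤ t) (h1 : t ≤ 1) (y : C → ℝ) : 0 ≤ shiftScale t y :=
  add_nonneg (sub_nonneg.mpr h1) (mul_nonneg h0 (minPos_nonneg y))

theorem shiftAmount_nonneg {t : ℝ} (h0 : 0 ≤ t) (y : C → ℝ) : 0 ≤ shiftAmount t y :=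
  mul_nonneg h0 (norm_nonneg _)

theorem shiftScale_zero (y : C → ℝ) : shiftScale 0 y = 1 := by simp [shiftScale]

theorem shiftAmount_zero (y : C → ℝ) : shiftAmount 0 y = 0 := by simp [shiftAmount]

theorem shift_zero (y : C → ℝ) : shift 0 y = y := by
  ext c
  simp [shift, shiftScale_zero, shiftAmount_zero]

/-- A zero means that scale times `y` is constant. If the scale is 0, then `t = 1` and `minPos y =
0`, so the amount is `‖y‖ ≠ 0`. If it is positive, `y` is a constant `k ≥ 0`, so `minPos y = k`, the
amount is 0, and `y = 0`. -/
theorem shift_ne_zero {t : ℝ} (h0 : 0 ≤ t) (h1 : t ≤ 1) {y : C → ℝ} (hy : y ≠ 0) :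
    shift t y ≠ 0 := by
  intro h
  have h' : ∀ c, shiftScale t y * y c = shiftAmount t y := fun c =>
    sub_eq_zero.mp (congrFun h c)
  rcases (shiftScale_nonneg h0 h1 y).eq_or_lt with ha | ha
  · have hm : t * minPos y = 0 := le_antisymm (by unfold shiftScale at ha; linarith)
      (mul_nonneg h0 (minPos_nonneg y))
    have ht : t = 1 := by unfold shiftScale at ha; linarith
    subst ht
    have hb := h' (Classical.arbitrary C)
    rw [one_mul] at hm
    rw [← ha, zero_mul, shiftAmount, hm, one_mul] at hb
    exact hy (sub_zero y ▸ norm_eq_zero.mp hb.symm)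
  · obtain ⟨k, hk⟩ : ∃ k, k = shiftAmount t y / shiftScale t y := ⟨_, rfl⟩
    have hyk : y = fun _ => k := by
      ext c
      rw [hk, eq_div_iff ha.ne', mul_comm, h' c]
    have hk0 : 0 ≤ k := hk ▸ div_nonneg (shiftAmount_nonneg h0 y) ha.le
    have : shiftAmount t y = 0 := by
      rw [shiftAmount, hyk, minPos_const hk0]
      simp
    rw [this, zero_div] at hk
    exact hy (hyk.trans (by rw [hk]; rfl))

theorem shift_one_of_minPos_eq_zero {y : C → ℝ} (h : minPos y = 0) :
    shift 1 y = ‖y‖ • fun _ => (-1 : ℝ) := by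
  ext c
  have : (y - fun _ => (0 : ℝ)) = y := sub_zero y
  simp [shift, shiftScale, shiftAmount, h, this]

/-- The base ray stays fixed at all times, so the induced motion of each sphere is pointed and
descends to the wedge. -/
theorem shift_const_neg {t k : ℝ} (hk : 0 ≤ k) :
    shift t (k • fun _ : C => (-1 : ℝ)) = k • fun _ => (-1 : ℝ) := by
  obtain ⟨c₀⟩ := ‹Nonempty C›
  have h : minPos (k • fun _ : C => (-1 : ℝ)) = 0 := minPos_eq_zero (c := c₀) (by simpa using hk)
  have h2 : ((k • fun _ : C => (-1 : ℝ)) - fun _ => (0 : ℝ)) = fun _ => -k := by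
    ext c; simp
  ext c
  simp only [shift, shiftScale, shiftAmount, h, h2]
  simp [abs_of_nonneg hk]
  ring

end Shift

/-! ### Coordinates on the sphere -/

section Direction

variable {d : ℕ} {C : Type*}

theorem exists_coordinates [Fintype C] [Nonempty C] (d : ℕ) (h : Fintype.card C = d + 1) :
    ∃ Φ : EuclideanSpace ℝ (Fin (d + 1)) ≃L[ℝ] (C → ℝ),
      Φ (UnitSphere.base d).1 = fun _ => -1 := by
  let Φ₀ : EuclideanSpace ℝ (Fin (d + 1)) ≃L[ℝ] (C → ℝ) :=
    ContinuousLinearEquiv.ofFinrankEq (by simp [h])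
  have h1 : Φ₀ (UnitSphere.base d).1 ≠ 0 := by
    rw [Ne, EmbeddingLike.map_eq_zero_iff]
    intro h
    have := (UnitSphere.base d).2
    simp [h] at this
  have h2 : (fun _ : C => (-1 : ℝ)) ≠ 0 := fun h => by
    have := congrFun h (Classical.arbitrary C)
    simp at this
  -- Any nonzero vector can be moved to any other by a linear automorphism; this one puts the
  -- sphere's base point on the ray of -1.
  obtain ⟨A, hA⟩ := SeparatingDual.exists_continuousLinearEquiv_apply_eq (R := ℝ) h1 h2
  exact ⟨Φ₀.trans A, hA⟩

/-- The point of the unit sphere in the direction of a nonzero vector. -/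
noncomputable def direction (Φ : EuclideanSpace ℝ (Fin (d + 1)) ≃L[ℝ] (C → ℝ)) (y : C → ℝ)
    (hy : y ≠ 0) : UnitSphere d :=
  ⟨‖Φ.symm y‖⁻¹ • Φ.symm y, by
    have : Φ.symm y ≠ 0 := by simpa using hy
    simp [norm_smul, this]⟩

variable (Φ : EuclideanSpace ℝ (Fin (d + 1)) ≃L[ℝ] (C → ℝ))

theorem direction_smul {k : ℝ} (hk : 0 < k) (w : UnitSphere d) (h : k • Φ w.1 ≠ 0) :
    direction Φ (k • Φ w.1) h = w := by
  have hw : ‖w.1‖ = 1 := by simp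
  ext1
  simp only [direction, map_smul, ContinuousLinearEquiv.symm_apply_apply, norm_smul, hw]
  rw [mul_one, Real.norm_of_nonneg hk.le, smul_smul, inv_mul_cancel₀ hk.ne', one_smul]

theorem coordinates_ne_zero (w : UnitSphere d) : Φ w.1 ≠ 0 := by
  have hw : ‖w.1‖ = 1 := by simp
  simp only [ne_eq, EmbeddingLike.map_eq_zero_iff]
  intro h
  simp [h] at hw

theorem coordinates_direction (y : C → ℝ) (hy : y ≠ 0) :
    ∃ k : ℝ, 0 < k ∧ Φ (direction Φ y hy).1 = k • y := by
  have : Φ.symm y ≠ 0 := by simpa using hy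
  exact ⟨‖Φ.symm y‖⁻¹, by positivity, by simp [direction]⟩

end Direction

/-! ### Maps into and out of a wedge of spheres -/

section Wedge

variable {d k : ℕ}

/-- The inclusion of a sphere into the wedge. -/
def sphereToWedge (i : Fin k) (w : UnitSphere d) : WedgeOfSpheres d k :=
  Quot.mk _ (Sum.inl ⟨i, w⟩)

/-- The base point of the wedge. -/
def wedgeBase (d k : ℕ) : WedgeOfSpheres d k := Quot.mk _ (Sum.inr ())

theorem continuous_sphereToWedge (i : Fin k) :
    Continuous (sphereToWedge i : UnitSphere d → WedgeOfSpheres d k) := by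
  have h : Continuous fun w : UnitSphere d => (⟨i, w⟩ : Σ _ : Fin k, UnitSphere d) :=
    continuous_sigmaMk (σ := fun _ : Fin k => UnitSphere d)
  exact continuous_quot_mk.comp (continuous_inl.comp h)

theorem sphereToWedge_base (i : Fin k) : sphereToWedge i (UnitSphere.base d) = wedgeBase d k :=
  Quot.sound (WedgeRel.glue (x := fun _ : Fin k => UnitSphere.base d) i)

theorem wedge_cases (z : WedgeOfSpheres d k) :
    (∃ i w, z = sphereToWedge i w) ∨ z = wedgeBase d k := by
  obtain ⟨(p | p), rfl⟩ := Quot.exists_rep z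
  · exact Or.inl ⟨p.1, p.2, rfl⟩
  · exact Or.inr rfl

/-- A map out of the wedge, from maps that agree on the base points. -/
def wedgeLift {Y : Type*} (f : Fin k → UnitSphere d → Y) (y : Y)
    (h : ∀ i, f i (UnitSphere.base d) = y) : WedgeOfSpheres d k → Y :=
  Quot.lift (Sum.elim (fun p => f p.1 p.2) fun _ => y) (by rintro _ _ ⟨i⟩; exact h i)

theorem continuous_wedgeLift {Y : Type*} [TopologicalSpace Y] {f : Fin k → UnitSphere d → Y}
    {y : Y} (h : ∀ i, f i (UnitSphere.base d) = y) (hf : ∀ i, Continuous (f i)) :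
    Continuous (wedgeLift f y h) :=
  continuous_quot_lift _ (Continuous.sumElim (continuous_sigma fun i => hf i) continuous_const)

end Wedge

/-! ### The homotopy equivalence between the join and the wedge -/

section Equivalence

variable {S C : Type*} [Fintype S] {q : S → C} {b : C → S}

theorem JoinSpace.continuous_normalize {Y : Type*} [TopologicalSpace Y] {t : Y → S → ℝ}
    (ht : Continuous t) (h0 : ∀ y v, 0 ≤ t y v)
    (h1 : ∀ y u v, q u = q v → u ≠ v → t y u = 0 ∨ t y v = 0) (h2 : ∀ y, ∃ v, t y v ≠ 0) :
    Continuous fun y => JoinSpace.normalize (q := q) (t y) (h0 y) (h1 y) (h2 y) := by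
  refine Continuous.subtype_mk (continuous_pi fun s => ?_) _
  have h : ∀ s, Continuous fun y => t y s := fun s => (continuous_apply s).comp ht
  exact (h s).div (continuous_finsetSum _ fun v _ => h v)
    fun y => (sum_pos_of_exists_ne_zero (h0 y) (h2 y)).ne'

/-- The point of the cross-polytope of `j` in the direction of `y`. -/
noncomputable def choicePoint (hb : ∀ c, q (b c) = c) (j : NonbaseChoice q b) (y : C → ℝ)
    (hy : y ≠ 0) : JoinSpace q :=
  JoinSpace.normalize (choiceWeight b j y) (choiceWeight_nonneg j y) (choiceWeight_disjoint j y)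
    (choiceWeight_exists_ne_zero j hb hy)

theorem signedWeight_choicePoint (hb : ∀ c, q (b c) = c) (j : NonbaseChoice q b) (y : C → ℝ)
    (hy : y ≠ 0) : ∃ k : ℝ, 0 < k ∧ signedWeight q b (choicePoint hb j y hy).1 = k • y := by
  refine ⟨(∑ s, choiceWeight b j y s)⁻¹, inv_pos.mpr (sum_pos_of_exists_ne_zero
    (choiceWeight_nonneg j y) (choiceWeight_exists_ne_zero j hb hy)), ?_⟩
  ext c
  rw [choicePoint, JoinSpace.normalize, signedWeight_div, signedWeight_choiceWeight j hb,
    Pi.smul_apply, smul_eq_mul, div_eq_inv_mul]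

theorem choicePoint_apply_eq_zero (hb : ∀ c, q (b c) = c) (j : NonbaseChoice q b) (y : C → ℝ)
    (hy : y ≠ 0) {s : S} (h : s ≠ b (q s)) (h' : s ≠ j (q s)) :
    (choicePoint hb j y hy).1 s = 0 := by
  simp [choicePoint, JoinSpace.normalize, choiceWeight, h, h']

theorem choicePoint_smul (hb : ∀ c, q (b c) = c) (j : NonbaseChoice q b) {y y' : C → ℝ}
    {m : ℝ} (hm : 0 < m) (h : y' = m • y) (hy' : y' ≠ 0) (hy : y ≠ 0) :
    choicePoint hb j y' hy' = choicePoint hb j y hy := by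
  subst h
  exact JoinSpace.normalize_eq_normalize hm.ne' (choiceWeight_smul j hm.le y)

theorem continuous_choicePoint {d : ℕ} (Φ : EuclideanSpace ℝ (Fin (d + 1)) ≃L[ℝ] (C → ℝ))
    (hb : ∀ c, q (b c) = c) (j : NonbaseChoice q b) : Continuous fun w : UnitSphere d =>
      choicePoint hb j (Φ w.1) (coordinates_ne_zero Φ w) :=
  JoinSpace.continuous_normalize ((continuous_choiceWeight j).comp
    (Φ.continuous.comp continuous_subtype_val)) _ _ _

/-- A point in the open simplex of `j` lies on no other cross-polytope, so the choice extracted in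
`collapse` is the expected one. -/
theorem choice_unique (x : JoinSpace q) {j j' : NonbaseChoice q b} (h : ∀ c, x.1 (j c) ≠ 0)
    (h' : ∀ s, s ≠ b (q s) → s ≠ j' (q s) → x.1 s = 0) : j = j' := by
  ext c
  by_contra hne
  refine h c (h' _ ?_ ?_)
  · rw [(j c).2.1]; exact (j c).2.2
  · rw [(j c).2.1]; exact hne

variable [Nonempty C]

open Classical in
/-- The barycentre of the simplex of base points. -/
noncomputable def basePoint (hb : ∀ c, q (b c) = c) : JoinSpace q :=
  JoinSpace.normalize (fun s => if s = b (q s) then 1 else 0)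
    (fun s => by split_ifs <;> simp)
    (fun u v huv hne => by
      split_ifs with h1 h2
      · exact absurd (h1.trans (by rw [huv, ← h2])) hne
      all_goals simp)
    ⟨b (Classical.arbitrary C), by simp [hb]⟩

/-- On the ray of -1 the weights at `j` vanish, so the point is independent of `j`; hence `expand`
respects the gluing. -/
theorem choicePoint_eq_basePoint (hb : ∀ c, q (b c) = c) (j : NonbaseChoice q b)
    (h : (fun _ : C => (-1 : ℝ)) ≠ 0) : choicePoint hb j (fun _ => -1) h = basePoint hb := by
  refine JoinSpace.normalize_eq_normalize (k := 1) one_ne_zero fun s => ?_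
  unfold choiceWeight
  split_ifs <;> simp

variable {d k : ℕ}

/-- The map that identifies each sphere of the wedge with a cross-polytope in the join. -/
noncomputable def expand (Φ : EuclideanSpace ℝ (Fin (d + 1)) ≃L[ℝ] (C → ℝ))
    (e : Fin k ≃ NonbaseChoice q b) (hΦ : Φ (UnitSphere.base d).1 = fun _ => -1)
    (hb : ∀ c, q (b c) = c) :
    WedgeOfSpheres d k → JoinSpace q :=
  wedgeLift (fun i w => choicePoint hb (e i) (Φ w.1) (coordinates_ne_zero Φ w)) (basePoint hb)
    (by
      intro i
      simp only [hΦ]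
      exact choicePoint_eq_basePoint hb (e i) _)

theorem continuous_expand (Φ : EuclideanSpace ℝ (Fin (d + 1)) ≃L[ℝ] (C → ℝ))
    (e : Fin k ≃ NonbaseChoice q b) (hΦ : Φ (UnitSphere.base d).1 = fun _ => -1)
    (hb : ∀ c, q (b c) = c) : Continuous (expand Φ e hΦ hb) :=
  continuous_wedgeLift _ fun i => continuous_choicePoint Φ hb (e i)

variable [Fintype C]

/-- The motion of the join that contracts everything outside the open simplices of the
nonbase choices to the base point. -/
noncomputable def slidePoint (hb : ∀ c, q (b c) = c) (t : unitInterval) (x : JoinSpace q) :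
    JoinSpace q :=
  JoinSpace.normalize
    (slideWeight q b (shiftScale t (signedWeight q b x.1)) (shiftAmount t (signedWeight q b x.1))
      x.1)
    (slideWeight_nonneg _ _ _)
    (slideWeight_disjoint (shiftAmount_nonneg t.2.1 _) x)
    (slideWeight_exists_ne_zero hb (shiftScale_nonneg t.2.1 t.2.2 _)
      (shiftAmount_nonneg t.2.1 _) x
      (Function.ne_iff.mp (shift_ne_zero t.2.1 t.2.2 (signedWeight_ne_zero x))))

theorem continuous_slidePoint (hb : ∀ c, q (b c) = c) :
    Continuous fun p : unitInterval × JoinSpace q => slidePoint hb p.1 p.2 := by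
  have hy : Continuous fun p : unitInterval × JoinSpace q =>
      ((p.1 : ℝ), signedWeight q b p.2.1) :=
    (continuous_subtype_val.comp continuous_fst).prodMk
      ((continuous_signedWeight q b).comp (continuous_subtype_val.comp continuous_snd))
  exact JoinSpace.continuous_normalize (continuous_slideWeight.comp
    ((continuous_shiftScale.comp hy).prodMk ((continuous_shiftAmount.comp hy).prodMk
      (continuous_subtype_val.comp continuous_snd)))) _ _ _

theorem slidePoint_zero (hb : ∀ c, q (b c) = c) (x : JoinSpace q) : slidePoint hb 0 x = x := by
  ext s
  simp only [slidePoint, JoinSpace.normalize, Set.Icc.coe_zero, shiftScale_zero,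
    shiftAmount_zero, slideWeight_one_zero hb, x.2.2.2, div_one]

theorem slidePoint_one_of_minPos_eq_zero (hb : ∀ c, q (b c) = c) (x : JoinSpace q)
    (h : minPos (signedWeight q b x.1) = 0) : slidePoint hb 1 x = basePoint hb := by
  have h1 : (signedWeight q b x.1 - fun _ => (0 : ℝ)) = signedWeight q b x.1 := sub_zero _
  refine JoinSpace.normalize_eq_normalize (k := ‖signedWeight q b x.1‖)
    (norm_ne_zero_iff.mpr (signedWeight_ne_zero x)) fun s => ?_
  simp only [slideWeight, Set.Icc.coe_one, shiftScale, shiftAmount, h, h1]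
  split_ifs <;> simp

theorem slidePoint_eq_choicePoint (hb : ∀ c, q (b c) = c) (t : unitInterval) (x : JoinSpace q)
    (j : NonbaseChoice q b) (hx : ∀ c, x.1 (j c) ≠ 0) :
    slidePoint hb t x = choicePoint hb j (shift t (signedWeight q b x.1))
      (shift_ne_zero t.2.1 t.2.2 (signedWeight_ne_zero x)) := by
  refine JoinSpace.normalize_eq_normalize one_ne_zero fun s => ?_
  rw [slideWeight_eq_choiceWeight j (shiftAmount_nonneg t.2.1 _) x hx, one_mul]
  rfl

variable (Φ : EuclideanSpace ℝ (Fin (d + 1)) ≃L[ℝ] (C → ℝ))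

/-- The direction, on the sphere, of the signed weight of a point that is moved by `shift`. -/
noncomputable def shiftDirection (b : C → S) (t : unitInterval) (x : JoinSpace q) : UnitSphere d :=
  direction Φ (shift t (signedWeight q b x.1))
    (shift_ne_zero t.2.1 t.2.2 (signedWeight_ne_zero x))

theorem continuous_shiftDirection {Y : Type*} [TopologicalSpace Y] {τ : Y → unitInterval}
    {f : Y → JoinSpace q} (hτ : Continuous τ) (hf : Continuous f) :
    Continuous fun y => shiftDirection Φ b (τ y) (f y) := by
  have hy : Continuous fun y => ((τ y : ℝ), signedWeight q b (f y).1) :=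
    (continuous_subtype_val.comp hτ).prodMk
      ((continuous_signedWeight q b).comp (continuous_subtype_val.comp hf))
  have h : Continuous fun y => Φ.symm (shift (τ y) (signedWeight q b (f y).1)) :=
    Φ.symm.continuous.comp (continuous_shift.comp hy)
  refine Continuous.subtype_mk ((h.norm.inv₀ fun y => ?_).smul h) _
  simpa using shift_ne_zero (τ y).2.1 (τ y).2.2 (signedWeight_ne_zero (f y))

theorem shiftDirection_eq_base (hΦ : Φ (UnitSphere.base d).1 = fun _ => -1) (t : unitInterval)
    (x : JoinSpace q) {k : ℝ} (hk : 0 < k)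
    (h : shift t (signedWeight q b x.1) = k • fun _ => (-1 : ℝ)) :
    shiftDirection Φ b t x = UnitSphere.base d := by
  have h' : shift t (signedWeight q b x.1) = k • Φ (UnitSphere.base d).1 := by rw [h, hΦ]
  have hne : k • Φ (UnitSphere.base d).1 ≠ 0 :=
    h' ▸ shift_ne_zero t.2.1 t.2.2 (signedWeight_ne_zero x)
  rw [← direction_smul Φ hk (UnitSphere.base d) hne]
  simp only [shiftDirection, h']

theorem shiftDirection_one_eq_base (hΦ : Φ (UnitSphere.base d).1 = fun _ => -1)
    (x : JoinSpace q) (h : minPos (signedWeight q b x.1) = 0) :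
    shiftDirection Φ b 1 x = UnitSphere.base d :=
  shiftDirection_eq_base Φ hΦ 1 x (norm_pos_iff.mpr (signedWeight_ne_zero x))
    (shift_one_of_minPos_eq_zero h)

theorem shiftDirection_choicePoint_base (hΦ : Φ (UnitSphere.base d).1 = fun _ => -1)
    (hb : ∀ c, q (b c) = c) (j : NonbaseChoice q b) (t : unitInterval) :
    shiftDirection Φ b t (choicePoint hb j (Φ (UnitSphere.base d).1) (coordinates_ne_zero Φ _)) =
      UnitSphere.base d := by
  obtain ⟨k, hk, h⟩ := signedWeight_choicePoint hb j _ (coordinates_ne_zero Φ (UnitSphere.base d))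
  refine shiftDirection_eq_base Φ hΦ t _ hk ?_
  rw [h, hΦ, shift_const_neg hk.le]

theorem shiftDirection_zero_choicePoint (hb : ∀ c, q (b c) = c) (j : NonbaseChoice q b)
    (w : UnitSphere d) :
    shiftDirection Φ b 0 (choicePoint hb j (Φ w.1) (coordinates_ne_zero Φ w)) = w := by
  obtain ⟨k, hk, h⟩ := signedWeight_choicePoint hb j _ (coordinates_ne_zero Φ w)
  have hne : k • Φ w.1 ≠ 0 := smul_ne_zero hk.ne' (coordinates_ne_zero Φ w)
  rw [← direction_smul Φ hk w hne]
  simp only [shiftDirection, Set.Icc.coe_zero, shift_zero, direction_smul Φ hk w hne, h]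

/-- If every signed weight were positive, the weighted points of the fibres would form such a
choice. -/
theorem minPos_eq_zero_of_not_exists_choice (x : JoinSpace q)
    (h : ¬ ∃ j : NonbaseChoice q b, ∀ c, x.1 (j c) ≠ 0) : minPos (signedWeight q b x.1) = 0 := by
  by_contra h'
  apply h
  have hpos : ∀ c, 0 < signedWeight q b x.1 c := fun c => by
    by_contra! hc
    exact h' (minPos_eq_zero hc)
  choose s h1 h2 h3 using fun c => exists_of_signedWeight_pos x (hpos c)
  exact ⟨fun c => ⟨s c, h1 c, h2 c⟩, fun c => by simpa [h3 c] using (hpos c).ne'⟩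

variable (e : Fin k ≃ NonbaseChoice q b)

open Classical in
/-- Collapse the complement of the open simplices of the nonbase choices, and wrap each of these
around its sphere. -/
noncomputable def collapse (x : JoinSpace q) : WedgeOfSpheres d k :=
  if h : ∃ j : NonbaseChoice q b, ∀ c, x.1 (j c) ≠ 0 then
    sphereToWedge (e.symm h.choose) (shiftDirection Φ b 1 x)
  else wedgeBase d k

theorem collapse_of_minPos_eq_zero (hΦ : Φ (UnitSphere.base d).1 = fun _ => -1)
    (x : JoinSpace q) (h : minPos (signedWeight q b x.1) = 0) :
    collapse Φ e x = wedgeBase d k := by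
  unfold collapse
  split_ifs with h'
  · rw [shiftDirection_one_eq_base Φ hΦ x h]
    exact sphereToWedge_base _
  · rfl

theorem collapse_of_mem_crossPolytope (hΦ : Φ (UnitSphere.base d).1 = fun _ => -1)
    (x : JoinSpace q) (i : Fin k) (h : ∀ s, s ≠ b (q s) → s ≠ e i (q s) → x.1 s = 0) :
    collapse Φ e x = sphereToWedge i (shiftDirection Φ b 1 x) := by
  by_cases h' : ∃ j : NonbaseChoice q b, ∀ c, x.1 (j c) ≠ 0
  · have : h'.choose = e i := choice_unique x h'.choose_spec h
    rw [collapse, dif_pos h', this, Equiv.symm_apply_apply]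
  · have hm := minPos_eq_zero_of_not_exists_choice x h'
    rw [collapse_of_minPos_eq_zero Φ e hΦ x hm, shiftDirection_one_eq_base Φ hΦ x hm]
    exact (sphereToWedge_base i).symm

theorem continuous_collapse (hΦ : Φ (UnitSphere.base d).1 = fun _ => -1) :
    Continuous (collapse Φ e : JoinSpace q → WedgeOfSpheres d k) := by
  -- A finite closed cover: `some i` is the closed cross-polytope of `e i`, and `none` is the set
  -- that goes to the base point. On each piece `collapse` has a single formula.
  let A : Option (Fin k) → Set (JoinSpace q) := fun o => o.elim
    {x | minPos (signedWeight q b x.1) = 0}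
    (fun i => {x | ∀ s, s ≠ b (q s) → s ≠ e i (q s) → x.1 s = 0})
  have hy : Continuous fun x : JoinSpace q => signedWeight q b x.1 :=
    (continuous_signedWeight q b).comp continuous_subtype_val
  refine (locallyFinite_of_finite A).continuous ?_ ?_ ?_
  · refine Set.eq_univ_of_forall fun x => Set.mem_iUnion.mpr ?_
    by_cases h : ∃ j : NonbaseChoice q b, ∀ c, x.1 (j c) ≠ 0
    · obtain ⟨j, hj⟩ := h
      refine ⟨some (e.symm j), fun s _ hs => ?_⟩
      rw [Equiv.apply_symm_apply] at hs
      exact (x.2.2.1 s (j (q s)) (j (q s)).2.1.symm hs).resolve_right (hj _)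
    · exact ⟨none, minPos_eq_zero_of_not_exists_choice x h⟩
  · rintro (_ | i)
    · exact isClosed_eq (continuous_minPos.comp hy) continuous_const
    · simp only [A, Option.elim, Set.ofPred_forall]
      exact isClosed_iInter fun s => isClosed_iInter fun _ => isClosed_iInter fun _ =>
        isClosed_eq ((continuous_apply s).comp continuous_subtype_val) continuous_const
  · rintro (_ | i)
    · exact continuousOn_const.congr fun x hx => collapse_of_minPos_eq_zero Φ e hΦ x hx
    · have hc : Continuous fun x : JoinSpace q =>
          (sphereToWedge i (shiftDirection Φ b 1 x) : WedgeOfSpheres d k) :=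
        (continuous_sphereToWedge i).comp
          (continuous_shiftDirection Φ continuous_const continuous_id)
      exact hc.continuousOn.congr fun x hx => collapse_of_mem_crossPolytope Φ e hΦ x i hx

/-- Passing to the unit sphere only rescales the shifted vector by a positive factor, which
`choicePoint` ignores. -/
theorem expand_collapse (hΦ : Φ (UnitSphere.base d).1 = fun _ => -1) (hb : ∀ c, q (b c) = c)
    (x : JoinSpace q) : expand Φ e hΦ hb (collapse Φ e x) = slidePoint hb 1 x := by
  by_cases h : ∃ j : NonbaseChoice q b, ∀ c, x.1 (j c) ≠ 0
  · rw [collapse, dif_pos h, slidePoint_eq_choicePoint hb 1 x h.choose h.choose_spec]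
    obtain ⟨m, hm, hm'⟩ := coordinates_direction Φ (shift (1 : unitInterval) (signedWeight q b x.1))
      (shift_ne_zero zero_le_one le_rfl (signedWeight_ne_zero x))
    have := choicePoint_smul hb (e (e.symm h.choose)) hm hm' (coordinates_ne_zero Φ _)
      (shift_ne_zero zero_le_one le_rfl (signedWeight_ne_zero x))
    refine Eq.trans this ?_
    simp only [Equiv.apply_symm_apply]
  · have hm := minPos_eq_zero_of_not_exists_choice x h
    rw [collapse_of_minPos_eq_zero Φ e hΦ x hm, slidePoint_one_of_minPos_eq_zero hb x hm]
    rfl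

/-- The motion of the wedge that moves each sphere by `shiftDirection`. -/
noncomputable def slideWedge (hΦ : Φ (UnitSphere.base d).1 = fun _ => -1)
    (hb : ∀ c, q (b c) = c) : WedgeOfSpheres d k → C(unitInterval, WedgeOfSpheres d k) :=
  wedgeLift
    (fun i w => ⟨fun t => sphereToWedge i (shiftDirection Φ b t
        (choicePoint hb (e i) (Φ w.1) (coordinates_ne_zero Φ w))),
      (continuous_sphereToWedge i).comp 
        (continuous_shiftDirection Φ continuous_id continuous_const)⟩)
    (ContinuousMap.const _ (wedgeBase d k))
    (by
      intro i
      ext t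
      exact (congrArg (sphereToWedge i) (shiftDirection_choicePoint_base Φ hΦ hb (e i) t)).trans
        (sphereToWedge_base i))

/-- With values in the path space, continuity can be checked on each sphere, which avoids the
product of a quotient with the interval. -/
theorem continuous_slideWedge (hΦ : Φ (UnitSphere.base d).1 = fun _ => -1)
    (hb : ∀ c, q (b c) = c) : Continuous (slideWedge Φ e hΦ hb) := by
  refine continuous_wedgeLift _ fun i => ContinuousMap.continuous_of_continuous_uncurry _ ?_
  exact (continuous_sphereToWedge i).comp (continuous_shiftDirection Φ continuous_snd
    ((continuous_choicePoint Φ hb (e i)).comp continuous_fst))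

theorem slideWedge_zero (hΦ : Φ (UnitSphere.base d).1 = fun _ => -1) (hb : ∀ c, q (b c) = c)
    (z : WedgeOfSpheres d k) : slideWedge Φ e hΦ hb z 0 = z := by
  rcases wedge_cases z with ⟨i, w, rfl⟩ | rfl
  · exact congrArg (sphereToWedge i) (shiftDirection_zero_choicePoint Φ hb (e i) w)
  · rfl

theorem slideWedge_one (hΦ : Φ (UnitSphere.base d).1 = fun _ => -1) (hb : ∀ c, q (b c) = c)
    (z : WedgeOfSpheres d k) :
    slideWedge Φ e hΦ hb z 1 = collapse Φ e (expand Φ e hΦ hb z) := by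
  rcases wedge_cases z with ⟨i, w, rfl⟩ | rfl
  · exact (collapse_of_mem_crossPolytope Φ e hΦ _ i
      fun s h h' => choicePoint_apply_eq_zero hb _ _ _ h h').symm
  · refine (collapse_of_minPos_eq_zero Φ e hΦ _ ?_).symm
    refine minPos_eq_zero_of_not_exists_choice _ ?_
    rintro ⟨j, hj⟩
    refine hj (Classical.arbitrary C) ?_
    have := (j (Classical.arbitrary C)).2
    simp [expand, wedgeLift, wedgeBase, basePoint, JoinSpace.normalize, this.1, this.2]

/-- A join of finite discrete spaces is homotopy equivalent to a wedge of spheres. -/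
theorem JoinSpace.nonempty_homotopyEquiv (hb : ∀ c, q (b c) = c)
    (hd : Fintype.card C = d + 1) (e : Fin k ≃ NonbaseChoice q b) :
    Nonempty (JoinSpace q ≃ₕ WedgeOfSpheres d k) := by
  obtain ⟨Φ, hΦ⟩ := exists_coordinates d hd
  refine ⟨⟨⟨_, continuous_collapse Φ e hΦ⟩, ⟨_, continuous_expand Φ e hΦ hb⟩,
    -- Both motions run from the identity to the composite, hence the `symm`.
    ContinuousMap.Homotopic.symm ⟨⟨⟨_, continuous_slidePoint hb⟩, fun x => slidePoint_zero hb x,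
      fun x => (expand_collapse Φ e hΦ hb x).symm⟩⟩,
    ContinuousMap.Homotopic.symm ⟨⟨⟨_, (ContinuousMap.continuous_uncurry_of_continuous
        ⟨_, continuous_slideWedge Φ e hΦ hb⟩).comp continuous_swap⟩,
      fun x => slideWedge_zero Φ e hΦ hb x, fun x => slideWedge_one Φ e hΦ hb x⟩⟩⟩⟩

end Equivalence

/-! ### Transitive commuting structures -/

namespace CommutingStructure

variable {S : Type*} (A : CommutingStructure S) (hA : A.IsTransitive)

theorem mk_eq_mk_iff (x y : S) :
    Quotient.mk (A.toSetoid hA) x = Quotient.mk (A.toSetoid hA) y ↔ A.rel x y :=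
  Quotient.eq

theorem realization_iff [Fintype S] (t : S → ℝ) :
    ((∀ v, 0 ≤ t v) ∧ ∃ s ∈ A.NC.faces, (∀ v, v ∉ s → t v = 0) ∧ ∑ v ∈ s, t v = 1) ↔
      ((∀ v, 0 ≤ t v) ∧ (∀ u v, Quotient.mk (A.toSetoid hA) u = Quotient.mk (A.toSetoid hA) v →
        u ≠ v → t u = 0 ∨ t v = 0) ∧ ∑ v, t v = 1) := by
  classical
  refine and_congr_right fun _ => ⟨?_, ?_⟩
  · rintro ⟨s, hs, h1, h2⟩
    refine ⟨fun u v huv hne => ?_, ?_⟩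
    · by_contra! h
      have hu : u ∈ s := by_contra fun h' => h.1 (h1 u h')
      have hv : v ∈ s := by_contra fun h' => h.2 (h1 v h')
      exact (hs.2 u hu v hv).elim hne fun h' => h' ((A.mk_eq_mk_iff hA u v).mp huv)
    · rw [← h2]
      exact (Finset.sum_subset (Finset.subset_univ s) fun v _ hv => h1 v hv).symm
  · rintro ⟨h1, h2⟩
    -- The support of `t` is the face: weighted points of one class must coincide.
    refine ⟨Finset.univ.filter fun v => t v ≠ 0, ⟨?_, fun u hu v hv => ?_⟩, ?_, ?_⟩
    · by_contra h
      rw [Finset.not_nonempty_iff_eq_empty] at h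
      have : ∀ v, t v = 0 := by simpa [Finset.filter_eq_empty_iff] using h
      simp [this] at h2
    · rw [Finset.mem_filter_univ] at hu hv
      by_cases hne : u = v
      · exact Or.inl hne
      · refine Or.inr fun h => ?_
        exact (h1 u v ((A.mk_eq_mk_iff hA u v).mpr h) hne).elim hu hv
    · intro v hv
      simpa using hv
    · rw [Finset.sum_filter_ne_zero, h2]

/-- The truncated subtraction is a true one, since `b c` lies in the class `c`. -/
theorem card_nonbaseChoice [Finite S] (b : A.Classes hA → S)
    (hb : ∀ c, Quotient.mk (A.toSetoid hA) (b c) = c) :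
    Nat.card (NonbaseChoice (Quotient.mk (A.toSetoid hA)) b) =
      ∏ᶠ c : A.Classes hA, (A.classSize hA c - 1) := by
  classical
  have := Fintype.ofFinite S
  have := Fintype.ofFinite (A.Classes hA)
  rw [finprod_eq_prod_of_fintype, Nat.card_pi]
  refine Finset.prod_congr rfl fun c _ => ?_
  have h : {s : S | Quotient.mk (A.toSetoid hA) s = c ∧ s ≠ b c} =
      {s : S | Quotient.mk (A.toSetoid hA) s = c} \ {b c} := by
    ext; simp
  exact (congrArg Set.ncard h).trans (Set.ncard_sdiff_singleton_of_mem (hb c))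

theorem nonempty_realization_homotopyEquiv [Finite S] [Nonempty S] :
    ∃ d : ℕ, Nat.card (A.Classes hA) = d + 1 ∧
      Nonempty (Realization A.NC ≃ₕ
        WedgeOfSpheres d (∏ᶠ c : A.Classes hA, (A.classSize hA c - 1))) := by
  classical
  have := Fintype.ofFinite S
  have := Fintype.ofFinite (A.Classes hA)
  have : Nonempty (A.Classes hA) := ‹Nonempty S›.map (Quotient.mk _)
  obtain ⟨d, hd⟩ : ∃ d, Nat.card (A.Classes hA) = d + 1 :=
    Nat.exists_eq_succ_of_ne_zero Nat.card_pos.ne'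
  refine ⟨d, hd, ?_⟩
  choose b hb using Quotient.exists_rep (s := A.toSetoid hA)
  rw [← A.card_nonbaseChoice hA b hb]
  obtain ⟨h⟩ := JoinSpace.nonempty_homotopyEquiv (q := Quotient.mk (A.toSetoid hA)) (d := d) hb
    (by rw [← Nat.card_eq_fintype_card, hd]) (Finite.equivFin _).symm
  have φ : Realization A.NC ≃ₜ JoinSpace (Quotient.mk (A.toSetoid hA)) :=
    (Homeomorph.refl (S → ℝ)).subtype (A.realization_iff hA)
  exact ⟨φ.toHomotopyEquiv.trans h⟩

end CommutingStructure

/-! ### TC-groups -/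

section Group

open CommutingStructure

variable {G : Type*} [Group G] (hG : IsTCGroup G)

theorem centralizer_le_of_commute (hG : IsTCGroup G) {x y : G} (hx : x ∉ Subgroup.center G)
    (hy : y ∉ Subgroup.center G) (h : Commute x y) :
    Subgroup.centralizer {x} ≤ Subgroup.centralizer {y} := by
  intro z hz
  rw [Subgroup.mem_centralizer_singleton_iff] at hz ⊢
  by_cases hzc : z ∈ Subgroup.center G
  · exact (Subgroup.mem_center_iff.mp hzc y).symm
  · exact hG ⟨z, hzc⟩ ⟨x, hx⟩ ⟨y, hy⟩ hz h

/-- The centralizer of the elements of a class of noncentral elements. -/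
def classCentralizer (c : (noncentral G).Classes hG) : properCentralizers G :=
  Quotient.lift (s := (noncentral G).toSetoid hG)
    (fun x => ⟨Subgroup.centralizer {x.1}, ⟨x.1, rfl⟩, fun h => x.2 <| by
      rwa [Subgroup.centralizer_eq_top_iff_subset, Set.singleton_subset_iff] at h⟩)
    (fun x y h => Subtype.ext <| le_antisymm (centralizer_le_of_commute hG x.2 y.2 h)
      (centralizer_le_of_commute hG y.2 x.2 h.symm)) c

/-- Injective because `x` lies in its own centralizer; surjective because a proper centralizer comes
from a noncentral element. -/
theorem classCentralizer_bijective : Function.Bijective (classCentralizer hG) := by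
  constructor
  · intro c c'
    refine Quotient.inductionOn₂ c c' fun x y h => Quotient.sound ?_
    have h' : Subgroup.centralizer {x.1} = Subgroup.centralizer {y.1} := congrArg Subtype.val h
    have : x.1 ∈ Subgroup.centralizer {y.1} := by
      rw [← h', Subgroup.mem_centralizer_singleton_iff]
    exact Subgroup.mem_centralizer_singleton_iff.mp this
  · rintro ⟨_, ⟨x, rfl⟩, h⟩
    refine ⟨Quotient.mk _ ⟨x, fun hx => h ?_⟩, rfl⟩
    rwa [Subgroup.centralizer_eq_top_iff_subset, Set.singleton_subset_iff]

theorem classSize_eq_ncard (c : (noncentral G).Classes hG) :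
    (noncentral G).classSize hG c =
      (((classCentralizer hG c).1 : Set G) \ (Subgroup.center G : Set G)).ncard := by
  refine Quotient.inductionOn c fun x => ?_
  have h : (((classCentralizer hG (Quotient.mk _ x)).1 : Set G) \ (Subgroup.center G : Set G)) =
      Subtype.val '' {y : {g : G // g ∉ Subgroup.center G} |
        Quotient.mk ((noncentral G).toSetoid hG) y = Quotient.mk _ x} := by
    ext y
    simp only [Set.mem_sdiff, SetLike.mem_coe, Set.mem_image, Set.mem_ofPred_eq, Subtype.exists,
      exists_and_right, exists_eq_right]
    exact ⟨fun h => ⟨h.2, (mk_eq_mk_iff _ hG _ _).mpr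
        (Subgroup.mem_centralizer_singleton_iff.mp h.1)⟩,
      fun ⟨h, h'⟩ => ⟨Subgroup.mem_centralizer_singleton_iff.mpr
        ((mk_eq_mk_iff _ hG _ _).mp h'), h⟩⟩
  rw [h, Set.ncard_image_of_injective _ Subtype.val_injective]
  rfl

theorem finprod_classSize_eq :
    ∏ᶠ c : (noncentral G).Classes hG, ((noncentral G).classSize hG c - 1) =
      ∏ᶠ H ∈ properCentralizers G,
        (((H : Set G) \ (Subgroup.center G : Set G)).ncard - 1) := by
  rw [← finprod_set_coe_eq_finprod_mem]
  exact finprod_eq_of_bijective _ (classCentralizer_bijective hG)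
    fun c => by rw [classSize_eq_ncard]

/-- A non-commuting set with at least two elements avoids the center and meets each class at most
once; class representatives attain the bound. -/
theorem nc_eq_card_classes [Finite G] (hne : ∃ x y : G, ¬ Commute x y) :
    nc G = Nat.card ((noncentral G).Classes hG) := by
  classical
  have hbound : ∀ k ∈ {k | ∃ s : Finset G, (s : Set G).Pairwise (fun x y => ¬ Commute x y) ∧
      s.card = k}, k ≤ Nat.card ((noncentral G).Classes hG) := by
    rintro _ ⟨s, hs, rfl⟩
    -- A singleton may be central, so it yields no class; there the bound needs only that some
    -- noncentral element exists.
    rcases le_or_gt s.card 1 with h1 | h1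
    · obtain ⟨x, y, hxy⟩ := hne
      have : Nonempty ((noncentral G).Classes hG) :=
        ⟨Quotient.mk _ ⟨x, fun hx => hxy (Subgroup.mem_center_iff.mp hx y).symm⟩⟩
      exact h1.trans Nat.card_pos
    · have hc : ∀ x ∈ s, x ∉ Subgroup.center G := by
        intro x hx hxc
        obtain ⟨y, hy, hyx⟩ := Finset.exists_mem_ne h1 x
        exact hs hy hx hyx (Subgroup.mem_center_iff.mp hxc y)
      have hinj : Function.Injective fun x : s =>
          Quotient.mk ((noncentral G).toSetoid hG) ⟨x.1, hc x.1 x.2⟩ := by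
        intro x y h
        by_contra hxy
        exact hs x.2 y.2 (fun h => hxy (Subtype.ext h)) ((mk_eq_mk_iff _ hG _ _).mp h)
      simpa using Nat.card_le_card_of_injective _ hinj
  refine le_antisymm (csSup_le' hbound) (le_csSup ⟨_, hbound⟩ ?_)
  choose b hb using Quotient.exists_rep (s := (noncentral G).toSetoid hG)
  have := Fintype.ofFinite ((noncentral G).Classes hG)
  have hinj : Function.Injective fun c => (b c).1 := fun c c' h => by
    rw [← hb c, ← hb c', Subtype.ext h]
  refine ⟨Finset.univ.image fun c => (b c).1, ?_, ?_⟩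
  · intro x hx y hy hxy h
    simp only [Finset.coe_image, Finset.coe_univ, Set.image_univ, Set.mem_range] at hx hy
    obtain ⟨c, rfl⟩ := hx
    obtain ⟨c', rfl⟩ := hy
    apply hxy
    have : c = c' := by
      rw [← hb c, ← hb c']
      exact (mk_eq_mk_iff _ hG _ _).mpr h
    rw [this]
  · rw [Finset.card_image_of_injective _ hinj, Finset.card_univ, Nat.card_eq_fintype_card]

end Group

theorem mainTheorem6 :
    (∀ (S : Type*) [Finite S] [Nonempty S] (A : CommutingStructure S) (hA : A.IsTransitive),
      ∃ d : ℕ, Nat.card (A.Classes hA) = d + 1 ∧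
        Nonempty (Realization A.NC ≃ₕ
          WedgeOfSpheres d (∏ᶠ c : A.Classes hA, (A.classSize hA c - 1)))) ∧
    (∀ (G : Type*) [Group G] [Finite G], (∃ x y : G, ¬ Commute x y) → IsTCGroup G →
      ∃ d : ℕ, nc G = d + 1 ∧
        Nonempty (Realization (BNC G) ≃ₕ
          WedgeOfSpheres d (∏ᶠ H ∈ properCentralizers G,
            (((H : Set G) \ (Subgroup.center G : Set G)).ncard - 1)))) := by
  refine ⟨fun S _ _ A hA => A.nonempty_realization_homotopyEquiv hA, fun G _ _ hne hG => ?_⟩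
  have : Nonempty {g : G // g ∉ Subgroup.center G} := by
    obtain ⟨x, y, hxy⟩ := hne
    exact ⟨⟨x, fun hx => hxy (Subgroup.mem_center_iff.mp hx y).symm⟩⟩
  rw [nc_eq_card_classes hG hne, ← finprod_classSize_eq hG]
  exact (CommutingStructure.noncentral G).nonempty_realization_homotopyEquiv hG
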